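/- Let $\mathfrak g$ be a finite-dimensional real Lie algebra. For $\alpha\in\mathfrak g^*$ let $d\alpha(X,Y)=-\alpha([X,Y])$; call $\alpha$ closed if $d\alpha=0$, and let $\mathcal O(\alpha)\subset\mathfrak g^*$ be the orbit of $\alpha$ under the coadjoint action of a connected Lie group with Lie algebra $\mathfrak g$. Suppose that $\mathfrak g=\mathfrak m\oplus I$ as a vector space, where $I$ is an abelian ideal of codimension $2$ and $\mathfrak m$ is a linear subspace, and that $\dim\mathcal O(\alpha)=4$ for every nonclosed $\alpha\in\mathfrak g^*$. Let $\{T_1,T_2\}$ be any basis of $\mathfrak m$. Then $\widetilde{\mathfrak g}=\mathbb R T_1\oplus I$ is an ideal of $\mathfrak g$ complementary to the line $\mathbb R T_2$ (so it is identified, as a vector space, with $\mathfrak g/\mathbb R T_2$, which carries its Lie bracket), and there is a derivation $f$ of the Lie algebra $\widetilde{\mathfrak g}$ such that: 1. $\mathfrak g$ is the one-dimensional extension of $\widetilde{\mathfrak g}$ by $f$: there is $T\neq 0$ in $\mathfrak g$ with $\mathfrak g=\widetilde{\mathfrak g}\oplus\mathbb R T$ and $[T,X]=f(X)$ for all $X\in\widetilde{\mathfrak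 g}$; moreover $f(X)=[T_2,X]$ for all $X\in I$; 2. $f(T_1)=0$; 3. $\operatorname{Im} f=\operatorname{Im}(\operatorname{ad}T_1)$; 4. for every nonzero $Y\in\operatorname{Im}(\operatorname{ad}T_1)$ there exist linearly independent $X_1,X_2\in I$ with $f(X_2)=[T_1,X_1]=Y$. -/

import Mathlib

noncomputable section

namespace Coadjoint

variable (g : Type*) [LieRing g] [LieAlgebra ℝ g] [Module.Finite ℝ g]

/-- The exponential of an endomorphism of a finite-dimensional real vector space, computed through
the matrix exponential in a basis (it does not depend on the basis). -/
def expEnd (A : Module.End ℝ g) : Module.End ℝ g :=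
  (LinearMap.toMatrixAlgEquiv (Module.finBasis ℝ g)).symm
    (NormedSpace.exp (LinearMap.toMatrixAlgEquiv (Module.finBasis ℝ g) A))

theorem expEnd_comp_neg (A : Module.End ℝ g) :
    expEnd g A ∘ₗ expEnd g (-A) = LinearMap.id := by
  change expEnd g A * expEnd g (-A) = 1
  unfold expEnd
  rw [← map_mul, map_neg]
  generalize LinearMap.toMatrixAlgEquiv (Module.finBasis ℝ g) A = M
  have hM : Commute M (-M) := by rw [Commute, SemiconjBy, mul_neg, neg_mul]
  rw [← Matrix.exp_add_of_commute M (-M) hM, add_neg_cancel, NormedSpace.exp_zero, map_one]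

variable {g}

/-- `Ad (exp X) = exp (ad X)`. -/
def expAd (X : g) : g ≃ₗ[ℝ] g :=
  LinearEquiv.ofLinearMap (expEnd g (LieAlgebra.ad ℝ g X)) (expEnd g (-LieAlgebra.ad ℝ g X))
    (expEnd_comp_neg g _) (by simpa using expEnd_comp_neg g (-LieAlgebra.ad ℝ g X))

variable (g)

/-- The adjoint group, i.e. the image `Ad(G)` of any connected Lie group `G` with Lie algebra `g`:
the group generated by all `exp (ad X)`. -/
def adjointGroup : Subgroup (g ≃ₗ[ℝ] g) :=
  Subgroup.closure (Set.range (expAd : g → g ≃ₗ[ℝ] g))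

variable {g}

/-- `Ad (exp X)` as an element of the adjoint group. -/
def Ad (X : g) : adjointGroup g := ⟨expAd X, Subgroup.subset_closure ⟨X, rfl⟩⟩

/-- The coadjoint action `⟨Ad*(x) α, X⟩ = ⟨α, Ad(x⁻¹) X⟩` on the dual. -/
instance coadjointAction : MulAction (adjointGroup g) (Module.Dual ℝ g) where
  smul x α := α ∘ₗ ((x⁻¹ : adjointGroup g) : g ≃ₗ[ℝ] g).toLinearMap
  one_smul α := by
    ext X
    change α (((1 : adjointGroup g)⁻¹ : adjointGroup g).1 X) = α X
    simp
  mul_smul x y α := by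
    ext X
    change α (((x * y)⁻¹ : adjointGroup g).1 X) =
      α ((y⁻¹ : adjointGroup g).1 ((x⁻¹ : adjointGroup g).1 X))
    rw [mul_inv_rev]
    rfl

/-- The coadjoint orbit of `α`. -/
def coadjointOrbit (α : Module.Dual ℝ g) : Set (Module.Dual ℝ g) :=
  MulAction.orbit (adjointGroup g) α

/-- The Lie algebra of the isotropy group `G_α` of `α` under the coadjoint action: the space of
all `X` whose one-parameter subgroup `exp (t X)` fixes `α`. -/
def isotropyAlgebra (α : Module.Dual ℝ g) : Submodule ℝ g :=
  Submodule.span ℝ {X : g | ∀ t : ℝ, Ad (t • X) ∈ MulAction.stabilizer (adjointGroup g) α}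

/-- The dimension of the coadjoint orbit of `α` as a manifold, namely as the homogeneous space
`G / G_α`, whose tangent space at the base point is `g / Lie(G_α)`. -/
def coadjointOrbitDim (α : Module.Dual ℝ g) : ℕ :=
  Module.finrank ℝ (g ⧸ isotropyAlgebra α)

/-- The linear form `α` is closed: `dα = 0`, where `dα (X, Y) = -α [X, Y]`. -/
def IsClosedForm (α : Module.Dual ℝ g) : Prop :=
  ∀ X Y : g, -α ⁅X, Y⁆ = 0

/-- `g` is the one-dimensional extension of its ideal `h` by the derivation `f` of `h`:
`g = h ⊕ ℝ T` as a vector space, with `T ≠ 0` and `[T, X] = f X` for all `X` in `h`. -/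
def IsOneDimExtension (h : LieIdeal ℝ g) (f : LieDerivation ℝ h h) : Prop :=
  ∃ T : g, T ≠ 0 ∧ IsCompl h.toSubmodule (Submodule.span ℝ {T}) ∧
    ∀ X : h, ⁅T, (X : g)⁆ = (f X : g)

end Coadjoint

end

open Module

/-! ### Radical of `dα` inside the isotropy algebra -/

section RadicalOfForm

/-! Let `W` lie outside `I`, completed by `W'` to a basis modulo `I`. If `α` kills `[W, I]`, then,
`I` being abelian, every `X ∈ I` with `α [W', X] = 0` is in the radical of `dα`. That radical has
codimension at most 3, so the orbit does not have dimension 4 and `α` is closed. By duality `[g, g]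
⊆ [W, I]`: all such `ad W` have the same image, already attained on `I`.

Hence `[T₁, i₀] = [T₁, T₂]` for some `i₀ ∈ I`, and `f = ad (T₂ - i₀)` kills `T₁` while agreeing with
`ad T₂` on `I`. Independence in item 4 comes from comparing the ranks of `ad T₁` and `ad (T₁ - c
T₂)` on `I`. -/

/-- A linear form killed by `A` is fixed by the exponential of `A`. -/
theorem Matrix.vecMul_exp_of_vecMul_eq_zero {n : Type*} [Fintype n] [DecidableEq n]
    {M : Matrix n n ℝ} {v : n → ℝ} (h : Matrix.vecMul v M = 0) :
    Matrix.vecMul v (NormedSpace.exp M) = v := by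
  let _ : NormedRing (Matrix n n ℝ) := Matrix.linftyOpNormedRing
  let _ : NormedAlgebra ℝ (Matrix n n ℝ) := Matrix.linftyOpNormedAlgebra
  let _ : NormedAlgebra ℚ (Matrix n n ℝ) := NormedAlgebra.restrictScalars ℚ ℝ _
  have hs : HasSum (fun k : ℕ => ((k.factorial : ℝ)⁻¹) • M ^ k) (NormedSpace.exp M) :=
    NormedSpace.exp_series_hasSum_exp' (𝕂 := ℝ) M
  let φ : Matrix n n ℝ →+ (n → ℝ) :=
    { toFun := fun N => Matrix.vecMul v N
      map_zero' := Matrix.vecMul_zero v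
      map_add' := fun N N' => Matrix.vecMul_add N N' v }
  have hφ : Continuous φ := continuous_const.matrix_vecMul continuous_id
  have hmap := hs.map φ hφ
  have hone : HasSum (φ ∘ fun k : ℕ => ((k.factorial : ℝ)⁻¹) • M ^ k) v := by
    have : v = (φ ∘ fun k : ℕ => ((k.factorial : ℝ)⁻¹) • M ^ k) 0 := by simp [φ]
    conv => arg 2; rw [this]
    refine hasSum_single 0 fun k hk => ?_
    obtain ⟨j, rfl⟩ := Nat.exists_eq_succ_of_ne_zero hk
    change Matrix.vecMul v (_ • M ^ (j + 1)) = 0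
    rw [Matrix.vecMul_smul, pow_succ', ← Matrix.vecMul_vecMul, h, Matrix.zero_vecMul, smul_zero]
  exact hmap.unique hone

variable {g : Type*} [LieRing g] [LieAlgebra ℝ g] [Module.Finite ℝ g]

theorem Coadjoint.comp_expEnd_of_comp_eq_zero {α : Dual ℝ g} {A : End ℝ g}
    (h : α ∘ₗ A = 0) : α ∘ₗ Coadjoint.expEnd g A = α := by
  let b := finBasis ℝ g
  let v : Fin (finrank ℝ g) → ℝ := fun i => α (b i)
  have key : ∀ (N : Matrix (Fin (finrank ℝ g)) (Fin (finrank ℝ g)) ℝ) (j),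
      α ((LinearMap.toMatrixAlgEquiv b).symm N (b j)) = Matrix.vecMul v N j := by
    intro N j
    change α (Matrix.toLinAlgEquiv b N (b j)) = _
    rw [Matrix.toLinAlgEquiv_self, map_sum]
    simp [Matrix.vecMul, dotProduct, v, mul_comm]
  have h0 : Matrix.vecMul v (LinearMap.toMatrixAlgEquiv b A) = 0 := by
    ext j
    rw [← key, AlgEquiv.symm_apply_apply]
    exact LinearMap.congr_fun h (b j)
  refine b.ext fun j => ?_
  change α ((LinearMap.toMatrixAlgEquiv b).symm
    (NormedSpace.exp (LinearMap.toMatrixAlgEquiv b A)) (b j)) = _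
  rw [key, Matrix.vecMul_exp_of_vecMul_eq_zero h0]

/-- If `α ∘ ad X = 0`, only the constant term of `α ∘ exp (t ad X)` survives. This one inclusion
suffices, since orbit dimensions are only bounded above. -/
theorem Coadjoint.mem_isotropyAlgebra {α : Dual ℝ g} {X : g} (h : ∀ Y, α ⁅X, Y⁆ = 0) :
    X ∈ Coadjoint.isotropyAlgebra α := by
  refine Submodule.subset_span fun t => ?_
  rw [← inv_mem_iff, MulAction.mem_stabilizer_iff]
  change α ∘ₗ (((Coadjoint.Ad (t • X))⁻¹⁻¹ : Coadjoint.adjointGroup g) :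
    g ≃ₗ[ℝ] g).toLinearMap = α
  rw [inv_inv]
  change α ∘ₗ Coadjoint.expEnd g (LieAlgebra.ad ℝ g (t • X)) = α
  refine Coadjoint.comp_expEnd_of_comp_eq_zero (LinearMap.ext fun Y => ?_)
  simp [h]

end RadicalOfForm

/-! ### Every bracket lies in `[W, I]` -/

section CodimensionTwoIdeal

variable {g : Type*} [LieRing g] [LieAlgebra ℝ g] [Module.Finite ℝ g]

/-- If the radical of `dα` contains the kernel of one linear form on an ideal of codimension two,
then the orbit of `α` has dimension at most three. -/
theorem Coadjoint.coadjointOrbitDim_le_three {I : LieIdeal ℝ g}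
    (hcodim : finrank ℝ (g ⧸ I.toSubmodule) = 2) {α φ : Dual ℝ g}
    (h : ∀ X ∈ I, φ X = 0 → ∀ Y, α ⁅X, Y⁆ = 0) :
    Coadjoint.coadjointOrbitDim α ≤ 3 := by
  -- The kernel of `L` is `I ∩ ker φ`, of codimension at most `2 + 1`.
  let L : g →ₗ[ℝ] (g ⧸ I.toSubmodule) × ℝ := I.toSubmodule.mkQ.prod φ
  have hL : LinearMap.ker L ≤ Coadjoint.isotropyAlgebra α := by
    intro X hX
    rw [LinearMap.ker_prod, Submodule.ker_mkQ] at hX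
    exact Coadjoint.mem_isotropyAlgebra (h X hX.1 hX.2)
  have h1 : finrank ℝ (LinearMap.range L) ≤ 3 := by
    refine (Submodule.finrank_le _).trans_eq ?_
    rw [finrank_prod, hcodim, finrank_self]
  have h2 := L.finrank_range_add_finrank_ker
  have h3 := (Coadjoint.isotropyAlgebra α).finrank_quotient_add_finrank
  have h4 := Submodule.finrank_mono hL
  change finrank ℝ (g ⧸ Coadjoint.isotropyAlgebra α) ≤ 3
  omega

/-- Every bracket is of the form `[W, X]` with `X ∈ I`, for each `W` that is part of a basis of a
complement of `I`. -/
theorem Coadjoint.exists_lie_eq {I : LieIdeal ℝ g} (hI : IsLieAbelian I)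
    (hcodim : finrank ℝ (g ⧸ I.toSubmodule) = 2)
    (horb : ∀ α : Dual ℝ g, ¬ Coadjoint.IsClosedForm α → Coadjoint.coadjointOrbitDim α = 4)
    {W W' : g} (hW : ∀ Y : g, ∃ a b : ℝ, ∃ i ∈ I, Y = a • W + b • W' + i) (Y Z : g) :
    ∃ X ∈ I, ⁅W, X⁆ = ⁅Y, Z⁆ := by
  by_contra hne
  have hmem : ⁅Y, Z⁆ ∉ I.toSubmodule.map (LieAlgebra.ad ℝ g W : g →ₗ[ℝ] g) := by
    rintro ⟨X, hX, hX'⟩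
    exact hne ⟨X, hX, hX'⟩
  -- Separate `[Y, Z]` from the subspace `[W, I]` by a linear form.
  obtain ⟨α, hα, hα'⟩ := Submodule.exists_le_ker_of_notMem hmem
  have hcl : Coadjoint.IsClosedForm α := by
    by_contra hcl
    have h4 := horb α hcl
    have h3 := Coadjoint.coadjointOrbitDim_le_three (α := α)
      (φ := α ∘ₗ (LieAlgebra.ad ℝ g W' : g →ₗ[ℝ] g)) hcodim ?_
    · omega
    intro X hX hφ U
    obtain ⟨a, b, i, hi, rfl⟩ := hW U
    have e1 : α ⁅W, X⁆ = 0 := hα' ⟨X, hX, rfl⟩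
    have e2 : α ⁅W', X⁆ = 0 := hφ
    have e3 : ⁅X, i⁆ = 0 := congrArg Subtype.val (hI.trivial ⟨X, hX⟩ ⟨i, hi⟩)
    rw [lie_add, lie_add, lie_smul, lie_smul, e3, ← lie_skew X W, ← lie_skew X W']
    rw [map_add, map_add, map_smul, map_smul, map_neg, map_neg, e1, e2]
    simp
  exact hα (by simpa using hcl Y Z)

end CodimensionTwoIdeal

theorem mainTheorem6 {g : Type*} [LieRing g] [LieAlgebra ℝ g] [Module.Finite ℝ g]
    (m : Submodule ℝ g) (I : LieIdeal ℝ g) (hmI : IsCompl m I.toSubmodule)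
    (hI : IsLieAbelian I) (hcodim : Module.finrank ℝ (g ⧸ I.toSubmodule) = 2)
    (horb : ∀ α : Module.Dual ℝ g,
      ¬ Coadjoint.IsClosedForm α → Coadjoint.coadjointOrbitDim α = 4)
    (T : Module.Basis (Fin 2) ℝ m) :
    ∃ h : LieIdeal ℝ g,
      h.toSubmodule = Submodule.span ℝ {(T 0 : g)} ⊔ I.toSubmodule ∧
      IsCompl h.toSubmodule (Submodule.span ℝ {(T 1 : g)}) ∧
      ∃ f : LieDerivation ℝ h h,
        Coadjoint.IsOneDimExtension h f ∧
        (∀ X : h, (X : g) ∈ I → (f X : g) = ⁅(T 1 : g), (X : g)⁆) ∧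
        (∀ X : h, (X : g) = (T 0 : g) → f X = 0) ∧
        (LinearMap.range (f : h →ₗ[ℝ] h)).map h.toSubmodule.subtype =
          LinearMap.range (LieAlgebra.ad ℝ g (T 0 : g) : g →ₗ[ℝ] g) ∧
        ∀ Y ∈ LinearMap.range (LieAlgebra.ad ℝ g (T 0 : g) : g →ₗ[ℝ] g), Y ≠ 0 →
          ∃ X₁ X₂ : h, (X₁ : g) ∈ I ∧ (X₂ : g) ∈ I ∧ LinearIndependent ℝ ![(X₁ : g), (X₂ : g)] ∧
            (f X₂ : g) = Y ∧ ⁅(T 0 : g), (X₁ : g)⁆ = Y := by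

  have hdec : ∀ Y : g, ∃ a b : ℝ, ∃ i ∈ I, Y = a • (T 0 : g) + b • (T 1 : g) + i := by
    intro Y
    obtain ⟨u, hu, i, hi, rfl⟩ := Submodule.mem_sup.mp
      (hmI.sup_eq_top ▸ Submodule.mem_top : Y ∈ m ⊔ I.toSubmodule)
    refine ⟨T.repr ⟨u, hu⟩ 0, T.repr ⟨u, hu⟩ 1, i, hi, ?_⟩
    have := congrArg Subtype.val (T.sum_repr ⟨u, hu⟩)
    rw [Fin.sum_univ_two] at this
    exact congrArg (· + i) this.symm
  have hind : ∀ a b : ℝ, a • (T 0 : g) + b • (T 1 : g) ∈ I → a = 0 ∧ b = 0 := by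
    intro a b hab
    have h0 := Submodule.disjoint_def.mp hmI.disjoint _
      (a • T 0 + b • T 1 : m).2 hab
    exact LinearIndependent.pair_iff.mp
      (by simpa [show ![T 0, T 1] = T from by ext i; fin_cases i <;> rfl] using T.linearIndependent :
        LinearIndependent ℝ ![T 0, T 1]) a b (Subtype.ext h0)
  -- The pencil `T₁ - c T₂` serves the dependent case of item 4.
  have hdec' : ∀ c : ℝ, ∀ Y : g, ∃ a b : ℝ, ∃ i ∈ I,
      Y = a • ((T 0 : g) - c • (T 1 : g)) + b • (T 1 : g) + i := by
    intro c Y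
    obtain ⟨a, b, i, hi, rfl⟩ := hdec Y
    exact ⟨a, b + a * c, i, hi, by module⟩
  have hA := Coadjoint.exists_lie_eq hI hcodim horb hdec
  have hB : ∀ Y Z : g, ∃ X ∈ I, ⁅(T 1 : g), X⁆ = ⁅Y, Z⁆ := by
    refine Coadjoint.exists_lie_eq (W' := (T 0 : g)) hI hcodim horb fun Y => ?_
    obtain ⟨a, b, i, hi, rfl⟩ := hdec Y
    exact ⟨b, a, i, hi, by abel⟩
  have hC := fun c => Coadjoint.exists_lie_eq hI hcodim horb (hdec' c)
  have hgI : ∀ Y Z : g, ⁅Y, Z⁆ ∈ I := by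
    intro Y Z
    obtain ⟨X, hX, h⟩ := hA Y Z
    exact h ▸ I.lie_mem hX
  let h : LieIdeal ℝ g :=
    { Submodule.span ℝ {(T 0 : g)} ⊔ I.toSubmodule with
      lie_mem := fun {Y Z} _ => Submodule.mem_sup_right (hgI Y Z) }
  have hIh : ∀ {X : g}, X ∈ I → X ∈ h := fun hX => Submodule.mem_sup_right hX
  have hT0 : (T 0 : g) ∈ h := Submodule.mem_sup_left (Submodule.mem_span_singleton_self _)
  have hmem : ∀ {X : g}, X ∈ h → ∃ a : ℝ, ∃ i ∈ I, X = a • (T 0 : g) + i := by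
    intro X hX
    obtain ⟨u, hu, i, hi, rfl⟩ := Submodule.mem_sup.mp hX
    obtain ⟨a, rfl⟩ := Submodule.mem_span_singleton.mp hu
    exact ⟨a, i, hi, rfl⟩
  obtain ⟨i₀, hi₀, hi₀'⟩ := hA (T 0 : g) (T 1 : g)
  -- Correcting `T₂` by `i₀` makes it commute with `T₁` without changing its action on the abelian
  -- ideal `I`.
  let S : g := (T 1 : g) - i₀
  have hS0 : ⁅S, (T 0 : g)⁆ = 0 := by
    rw [← lie_skew, lie_sub, hi₀', sub_self, neg_zero]
  have hSI : ∀ X ∈ I, ⁅S, X⁆ = ⁅(T 1 : g), X⁆ := by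
    intro X hX
    have : ⁅i₀, X⁆ = 0 := congrArg Subtype.val (hI.trivial ⟨i₀, hi₀⟩ ⟨X, hX⟩)
    rw [sub_lie, this, sub_zero]
  -- Used with `i = 0` for the line of `T₂` and with `i = i₀` for the line of `S`.
  have hcompl : ∀ i ∈ I, IsCompl h.toSubmodule (Submodule.span ℝ {(T 1 : g) - i}) := by
    intro i hi
    refine ⟨Submodule.disjoint_def.mpr fun X hX hX' => ?_,
      codisjoint_iff.mpr (eq_top_iff.mpr fun Y _ => ?_)⟩
    · obtain ⟨a, j, hj, rfl⟩ := hmem hX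
      obtain ⟨b, hb⟩ := Submodule.mem_span_singleton.mp hX'
      have hz := hind a (-b) (by
        have : a • (T 0 : g) + -b • (T 1 : g) = -(b • i) - j := by
          rw [neg_smul, ← sub_eq_add_neg, sub_eq_iff_eq_add, eq_sub_of_add_eq hb.symm, smul_sub]
          abel
        rw [this]
        exact sub_mem (neg_mem (I.smul_mem b hi)) hj)
      rw [← hb, neg_eq_zero.mp hz.2, zero_smul]
    · obtain ⟨a, b, j, hj, rfl⟩ := hdec Y
      refine Submodule.mem_sup.mpr ⟨a • (T 0 : g) + (b • i + j),
        Submodule.add_mem _ (h.smul_mem a hT0) (hIh (add_mem (I.smul_mem b hi) hj)),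
        b • ((T 1 : g) - i), Submodule.smul_mem _ b (Submodule.mem_span_singleton_self _), ?_⟩
      module
  let f : LieDerivation ℝ h h :=
    { toLinearMap := (LieAlgebra.ad ℝ g S : g →ₗ[ℝ] g).restrict (p := h.toSubmodule)
        (q := h.toSubmodule) fun _ _ => hIh (hgI _ _)
      leibniz' := fun X Y => Subtype.ext (by
        change ⁅S, ⁅(X : g), (Y : g)⁆⁆ = ⁅(X : g), ⁅S, (Y : g)⁆⁆ - ⁅(Y : g), ⁅S, (X : g)⁆⁆
        rw [leibniz_lie S, ← lie_skew (Y : g)]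
        abel) }
  have hf : ∀ X : h, (f X : g) = ⁅S, (X : g)⁆ := fun _ => rfl
  have hfI : ∀ X : h, (X : g) ∈ I → (f X : g) = ⁅(T 1 : g), (X : g)⁆ :=
    fun X hX => (hf X).trans (hSI _ hX)
  refine ⟨h, rfl, by simpa using hcompl 0 I.zero_mem, f,
    ⟨S, ?_, hcompl i₀ hi₀, fun X => (hf X).symm⟩, hfI, ?_, ?_, ?_⟩
  · intro hS
    have := hind 0 1 (by rw [zero_smul, one_smul, zero_add, sub_eq_zero.mp hS]; exact hi₀)
    exact one_ne_zero this.2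
  · intro X hX
    exact Subtype.ext (by rw [hf, hX, hS0]; rfl)
  · ext Z
    constructor
    · rintro ⟨_, ⟨X, rfl⟩, rfl⟩
      obtain ⟨U, -, hU⟩ := hA S X
      exact ⟨U, hU⟩
    · rintro ⟨U, rfl⟩
      obtain ⟨X, hX, hX'⟩ := hB (T 0 : g) U
      exact ⟨f ⟨X, hIh hX⟩, ⟨_, rfl⟩, (hfI ⟨X, hIh hX⟩ hX).trans hX'⟩
  · rintro _ ⟨U, rfl⟩ hY0
    change ⁅(T 0 : g), U⁆ ≠ 0 at hY0
    change ∃ X₁ X₂ : h, (X₁ : g) ∈ I ∧ (X₂ : g) ∈ I ∧ LinearIndependent ℝ ![(X₁ : g), (X₂ : g)] ∧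
            (f X₂ : g) = ⁅(T 0 : g), U⁆ ∧ ⁅(T 0 : g), (X₁ : g)⁆ = ⁅(T 0 : g), U⁆
    obtain ⟨X₁, hX₁, e₁⟩ := hA (T 0 : g) U
    obtain ⟨X₂, hX₂, e₂⟩ := hB (T 0 : g) U
    have hX₁0 : X₁ ≠ 0 := by
      rintro rfl
      exact hY0 (by rw [← e₁, lie_zero])
    by_cases hli : LinearIndependent ℝ ![X₁, X₂]
    · exact ⟨⟨X₁, hIh hX₁⟩, ⟨X₂, hIh hX₂⟩, hX₁, hX₂, hli, (hfI ⟨X₂, hIh hX₂⟩ hX₂).trans e₂, e₁⟩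
    rw [LinearIndependent.pair_iff' hX₁0] at hli
    push Not at hli
    obtain ⟨c, rfl⟩ := hli
    have hc : c ≠ 0 := by
      rintro rfl
      exact hY0 (by rw [← e₂, zero_smul, lie_zero])
    -- Here `X₂ = c X₁`, so `T₁ - c T₂` kills `X₁`. As `ad T₁` has the same rank on `I`, it kills
    -- some nonzero `K ∈ I`, and `X₁ + K` can replace `X₁`.
    let R : g → (I.toSubmodule →ₗ[ℝ] g) :=
      fun W => (LieAlgebra.ad ℝ g W : g →ₗ[ℝ] g) ∘ₗ I.toSubmodule.subtype
    have hrange : LinearMap.range (R (T 0 : g)) =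
        LinearMap.range (R ((T 0 : g) - c • (T 1 : g))) := by
      ext Z
      constructor
      · rintro ⟨X, rfl⟩
        obtain ⟨V, hV, e⟩ := hC c (T 0 : g) X
        exact ⟨⟨V, hV⟩, e⟩
      · rintro ⟨X, rfl⟩
        obtain ⟨V, hV, e⟩ := hA ((T 0 : g) - c • (T 1 : g)) X
        exact ⟨⟨V, hV⟩, e⟩
    have hker : LinearMap.ker (R (T 0 : g)) ≠ ⊥ := by
      intro hbot
      have r₁ := (R (T 0 : g)).finrank_range_add_finrank_ker
      have r₂ := (R ((T 0 : g) - c • (T 1 : g))).finrank_range_add_finrank_ker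
      rw [hbot, finrank_bot, hrange] at r₁
      have hbot' : LinearMap.ker (R ((T 0 : g) - c • (T 1 : g))) = ⊥ :=
        Submodule.finrank_eq_zero.mp (by omega)
      have hx : (⟨X₁, hX₁⟩ : I.toSubmodule) ∈
          LinearMap.ker (R ((T 0 : g) - c • (T 1 : g))) := by
        change ⁅(T 0 : g) - c • (T 1 : g), X₁⁆ = 0
        rw [sub_lie, smul_lie, ← lie_smul, e₁, e₂, sub_self]
      rw [hbot'] at hx
      exact hX₁0 (congrArg Subtype.val ((Submodule.mem_bot ℝ).mp hx))
    obtain ⟨⟨K, hK⟩, hK', hK0⟩ := Submodule.exists_mem_ne_zero_of_ne_bot hker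
    have eK : ⁅(T 0 : g), K⁆ = 0 := hK'
    have hK0' : K ≠ 0 := fun e => hK0 (Subtype.ext e)
    refine ⟨⟨X₁ + K, hIh (add_mem hX₁ hK)⟩, ⟨c • X₁, hIh hX₂⟩, add_mem hX₁ hK, hX₂, ?_,
      (hfI ⟨c • X₁, hIh hX₂⟩ hX₂).trans e₂, ?_⟩
    · refine LinearIndependent.pair_iff.mpr fun s t hst => ?_
      -- Applying `ad T₁` to the relation gives `(s + t c) Y = 0`; what remains is `s K = 0`.
      have hb := congrArg (fun Z => ⁅(T 0 : g), Z⁆) hst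
      simp only [lie_add, lie_smul, eK, e₁, add_zero, lie_zero] at hb
      rw [smul_smul, ← add_smul] at hb
      have hst0 : s + t * c = 0 := (smul_eq_zero.mp hb).resolve_right hY0
      have hsK : s • K = 0 := by
        have e : s • (X₁ + K) + t • c • X₁ = (s + t * c) • X₁ + s • K := by module
        change s • (X₁ + K) + t • c • X₁ = 0 at hst
        rwa [e, hst0, zero_smul, zero_add] at hst
      have hs : s = 0 := (smul_eq_zero.mp hsK).resolve_right hK0'
      rw [hs, zero_add] at hst0
      exact ⟨hs, (mul_eq_zero.mp hst0).resolve_right hc⟩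
    · change ⁅(T 0 : g), X₁ + K⁆ = _
      rw [lie_add, e₁, eK, add_zero]
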